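/- Let $K$ be a field of characteristic zero, $n \ge 0$, $R = K[X_1,\ldots,X_n]$, and let $A_n(K)$ be the $n$-th Weyl algebra, i.e. the $K$-algebra of operators on $R$ generated by multiplication by $X_1,\ldots,X_n$ and by the partial derivatives $\partial_1,\ldots,\partial_n$; thus $R \subseteq A_n(K)$ and $R$ is a left $A_n(K)$-module. For an ideal $L$ of $R$ and an $R$-module $N$ put $\Gamma_L(N)=\{m\in N : L^s m=0 \text{ for some } s\ge 1\}$; if $N$ is an $A_n(K)$-module then $\Gamma_L(N)$ is an $A_n(K)$-submodule. Let $E^\bullet$ be any injective resolution of $R$ by $R$-modules, and let $H^i_L(R) = H^i(\Gamma_L(E^\bullet))$ be the local cohomology modules. For ideals $I,J$ of $R$ the Mayer–Vietoris sequence $$\cdots \to H^{i}_{I+J}(R) \xrightarrow{\rho^i} H^i_I(R) \oplus H^i_J(R) \xrightarrow{\pi^i} H^i_{I\cap J}(R) \xrightarrow{\delta^i} H^{i+1}_{I+J}(R) \to \cdots$$ is the one induced by the short exact sequence of complexes $0 \to \Gamma_{I+J}(E^\bullet) \to \Gamma_I(E^\bullet)\oplus\Gamma_J(E^\bullet) \to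 \Gamma_{I\cap J}(E^\bullet)\to 0$, with maps $x\mapsto (x,x)$ and $(x,y)\mapsto x-y$. Then the Mayer–Vietoris sequence is a sequence of $A_n(K)$-modules. Precisely, all the $H^i_L(R)$ ($L$ an ideal of $R$, $i\ge 0$) carry $A_n(K)$-module structures that extend their $R$-module structures and have the following properties. 1. Let $Q^\bullet$ be any resolution of $R$ by injective left $A_n(K)$-modules. Then there is an $R$-linear chain map $Q^\bullet\to E^\bullet$ lifting the identity of $R$, and for every such chain map, every ideal $L$ and every $i\ge 0$ the induced map $H^i(\Gamma_L(Q^\bullet))\to H^i(\Gamma_L(E^\bullet)) = H^i_L(R)$ is bijective and $A_n(K)$-linear. (So the structure on $H^i_L(R)$ is the one obtained by computing local cohomology in the category of $A_n(K)$-modules, and it is determined by this.) 2. For all ideals $I,J$ of $R$ and all $i\ge 0$ the maps $\rho^i$, $\pi^i$ and the connecting map $\delta^i$ are $A_n(K)$-linear. -/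

import Mathlib

open CategoryTheory

universe u

namespace MVWeyl

/-! ### Torsion functors and local cohomology over a commutative ring -/

section LocalCohomology

variable {R : Type u} [CommRing R]

/-- The `L`-torsion submodule `Γ_L(M) = {m ∈ M | L ^ s m = 0 for some s}`. -/
def torsion (L : Ideal R) (M : Type u) [AddCommGroup M] [Module R M] : Submodule R M where
  carrier := {m | ∃ s : ℕ, ∀ a ∈ L ^ s, a • m = 0}
  zero_mem' := ⟨0, fun a _ => smul_zero a⟩
  add_mem' := by
    rintro x y ⟨s, hs⟩ ⟨t, ht⟩
    refine ⟨s + t, fun a ha => ?_⟩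
    rw [smul_add, hs a (Ideal.pow_le_pow_right (Nat.le_add_right s t) ha),
      ht a (Ideal.pow_le_pow_right (Nat.le_add_left t s) ha), add_zero]
  smul_mem' := by
    rintro r x ⟨s, hs⟩
    exact ⟨s, fun a ha => by rw [smul_comm, hs a ha, smul_zero]⟩

theorem mem_torsion {L : Ideal R} {M : Type u} [AddCommGroup M] [Module R M] {m : M} :
    m ∈ torsion L M ↔ ∃ s : ℕ, ∀ a ∈ L ^ s, a • m = 0 := Iff.rfl

theorem map_mem_torsion (L : Ideal R) {M N : Type u} [AddCommGroup M] [Module R M]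
    [AddCommGroup N] [Module R N] (f : M →ₗ[R] N) {m : M} (hm : m ∈ torsion L M) :
    f m ∈ torsion L N := by
  obtain ⟨s, hs⟩ := hm
  exact ⟨s, fun a ha => by rw [← map_smul, hs a ha, map_zero]⟩

/-- A larger ideal has less torsion. -/
theorem torsion_anti {L L' : Ideal R} (h : L ≤ L') (M : Type u) [AddCommGroup M] [Module R M] :
    torsion L' M ≤ torsion L M := by
  rintro m ⟨s, hs⟩
  exact ⟨s, fun a ha => hs a (Ideal.pow_right_mono h s ha)⟩

theorem torsion_sup (I J : Ideal R) (M : Type u) [AddCommGroup M] [Module R M] {m : M}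
    (h₁ : m ∈ torsion I M) (h₂ : m ∈ torsion J M) : m ∈ torsion (I ⊔ J) M := by
  obtain ⟨s, hs⟩ := h₁
  obtain ⟨t, ht⟩ := h₂
  refine ⟨s + t, fun a ha => ?_⟩
  obtain ⟨b, hb, c, hc, rfl⟩ := Submodule.mem_sup.1 (Ideal.sup_pow_add_le_pow_sup_pow ha)
  rw [add_smul, hs b hb, ht c hc, add_zero]

/-- The functor `Γ_L` on `R`-modules. -/
def torsionFunctor (L : Ideal R) : ModuleCat.{u} R ⥤ ModuleCat.{u} R where
  obj M := ModuleCat.of R (torsion L M)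
  map f := ModuleCat.ofHom (f.hom.restrict fun _ hm => map_mem_torsion L f.hom hm)
  map_id _ := rfl
  map_comp _ _ := rfl

instance (L : Ideal R) : (torsionFunctor L).Additive where
  map_add := rfl

/-- The complex `Γ_L(E)` for a cochain complex `E` of `R`-modules. -/
noncomputable abbrev torsionComplex (L : Ideal R) (E : CochainComplex (ModuleCat.{u} R) ℕ) :
    CochainComplex (ModuleCat.{u} R) ℕ :=
  ((torsionFunctor L).mapHomologicalComplex (ComplexShape.up ℕ)).obj E

/-- The local cohomology module `H^i_L(M)`: the value at `M` of the `i`-th right derived functor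
of `Γ_L`, computed as `H^i(Γ_L(E))` from an injective resolution `E` of `M`. -/
noncomputable abbrev localCoh (L : Ideal R) {M : ModuleCat.{u} R} (E : InjectiveResolution M)
    (i : ℕ) : ModuleCat.{u} R :=
  (torsionComplex L E.cocomplex).homology i

/-! ### The Mayer-Vietoris sequence -/

/-- The inclusion `Γ_{L'} ⟶ Γ_L` for `L ≤ L'`. -/
def torsionIncl {L L' : Ideal R} (h : L ≤ L') : torsionFunctor L' ⟶ torsionFunctor L where
  app M := ModuleCat.ofHom (Submodule.inclusion (torsion_anti h M))
  naturality _ _ _ := rfl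

/-- The functor `M ↦ Γ_I(M) × Γ_J(M)`. -/
def torsionProd (I J : Ideal R) : ModuleCat.{u} R ⥤ ModuleCat.{u} R where
  obj M := ModuleCat.of R (torsion I M × torsion J M)
  map f := ModuleCat.ofHom (((torsionFunctor I).map f).hom.prodMap ((torsionFunctor J).map f).hom)
  map_id _ := rfl
  map_comp _ _ := rfl

instance (I J : Ideal R) : (torsionProd I J).Additive where
  map_add := rfl

/-- `Γ_{I+J}(M) ⟶ Γ_I(M) × Γ_J(M)`, `x ↦ (x, x)`. -/
def mvDiag (I J : Ideal R) : torsionFunctor (I ⊔ J) ⟶ torsionProd I J where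
  app M := ModuleCat.ofHom
    ((Submodule.inclusion (torsion_anti le_sup_left M)).prod
      (Submodule.inclusion (torsion_anti le_sup_right M)))
  naturality _ _ _ := rfl

/-- `Γ_I(M) × Γ_J(M) ⟶ Γ_{I∩J}(M)`, `(x, y) ↦ x - y`. -/
def mvDiff (I J : Ideal R) : torsionProd I J ⟶ torsionFunctor (I ⊓ J) where
  app M := ModuleCat.ofHom
    ((Submodule.inclusion (torsion_anti inf_le_left M)).comp (LinearMap.fst R _ _) -
      (Submodule.inclusion (torsion_anti inf_le_right M)).comp (LinearMap.snd R _ _))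
  naturality M N f := by
    ext x
    apply Subtype.ext
    exact (map_sub f.hom (x.1 : M) (x.2 : M)).symm

theorem mvDiag_mvDiff (I J : Ideal R) (M : ModuleCat.{u} R) :
    (mvDiag I J).app M ≫ (mvDiff I J).app M = 0 := by
  ext x
  apply Subtype.ext
  exact sub_self x.1

/-- The sequence of complexes `Γ_{I+J}(E) ⟶ Γ_I(E) ⊕ Γ_J(E) ⟶ Γ_{I∩J}(E)`. -/
noncomputable def mvShortComplex (I J : Ideal R) (E : CochainComplex (ModuleCat.{u} R) ℕ) :
    ShortComplex (CochainComplex (ModuleCat.{u} R) ℕ) where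
  X₁ := torsionComplex (I ⊔ J) E
  X₂ := ((torsionProd I J).mapHomologicalComplex (ComplexShape.up ℕ)).obj E
  X₃ := torsionComplex (I ⊓ J) E
  f := (NatTrans.mapHomologicalComplex (mvDiag I J) (ComplexShape.up ℕ)).app E
  g := (NatTrans.mapHomologicalComplex (mvDiff I J) (ComplexShape.up ℕ)).app E
  zero := by
    ext1 j
    exact mvDiag_mvDiff I J (E.X j)

/-- `I ^ m ∩ J ^ s ⊆ (I ∩ J) ^ s` for large `m`, by Artin-Rees. -/
theorem exists_pow_inf_pow_le [IsNoetherianRing R] (I J : Ideal R) (s : ℕ) :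
    ∃ m : ℕ, I ^ m ⊓ J ^ s ≤ (I ⊓ J) ^ s := by
  obtain ⟨k, hk⟩ := Ideal.exists_pow_inf_eq_pow_smul I (J ^ s : Submodule R R)
  refine ⟨s + k, ?_⟩
  have h := hk (s + k) (Nat.le_add_left k s)
  rw [Nat.add_sub_cancel] at h
  have h1 : I ^ (s + k) ⊓ J ^ s = I ^ (s + k) • (⊤ : Submodule R R) ⊓ J ^ s := by
    rw [Ideal.smul_eq_mul, Ideal.mul_top]
  have h2 : I ^ s • (I ^ k • (⊤ : Submodule R R) ⊓ J ^ s) ≤ I ^ s * J ^ s :=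
    Ideal.mul_mono_right inf_le_right
  rw [h1, h]
  refine h2.trans ?_
  rw [← mul_pow]
  exact Ideal.pow_right_mono Ideal.mul_le_inf s

/-- For injective `M` over a Noetherian ring, `Γ_{I∩J}(M) = Γ_I(M) + Γ_J(M)`. -/
theorem exists_sub_eq [IsNoetherianRing R] (I J : Ideal R) (M : ModuleCat.{u} R)
    [Injective M] {x : M} (hx : x ∈ torsion (I ⊓ J) M) :
    ∃ y ∈ torsion I M, ∃ z ∈ torsion J M, y - z = x := by
  obtain ⟨s, hs⟩ := hx
  obtain ⟨m, hm⟩ := exists_pow_inf_pow_le I J s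
  let ψ : R →ₗ[R] (R ⧸ I ^ m) × (R ⧸ J ^ s) :=
    (Submodule.mkQ (I ^ m)).prod (Submodule.mkQ (J ^ s))
  have hker : ∀ r, ψ r = 0 ↔ r ∈ I ^ m ⊓ J ^ s := by
    intro r
    simp [ψ, Submodule.mem_inf, Ideal.Quotient.eq_zero_iff_mem]
  let ψ' : (R ⧸ (I ^ m ⊓ J ^ s)) →ₗ[R] (R ⧸ I ^ m) × (R ⧸ J ^ s) :=
    Submodule.liftQ _ ψ fun r hr => (hker r).2 hr
  have hψ' : Function.Injective ψ' := by
    rw [← LinearMap.ker_eq_bot, LinearMap.ker_eq_bot']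
    intro q hq
    obtain ⟨r, rfl⟩ := Submodule.mkQ_surjective _ q
    exact (Submodule.Quotient.mk_eq_zero _).2 ((hker r).1 hq)
  let φ : (R ⧸ (I ^ m ⊓ J ^ s)) →ₗ[R] M :=
    Submodule.liftQ _ (LinearMap.toSpanSingleton R M x) fun r hr => hs r (hm hr)
  have : Mono (ModuleCat.ofHom ψ') := (ModuleCat.mono_iff_injective _).2 hψ'
  let h : ModuleCat.of R ((R ⧸ I ^ m) × (R ⧸ J ^ s)) ⟶ M :=
    Injective.factorThru (ModuleCat.ofHom φ) (ModuleCat.ofHom ψ')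
  have hh : ModuleCat.ofHom ψ' ≫ h = ModuleCat.ofHom φ := Injective.comp_factorThru _ _
  have hx1 : h.hom (Submodule.mkQ (I ^ m) 1, Submodule.mkQ (J ^ s) 1) = x := by
    have := congrArg (fun f => f.hom (Submodule.mkQ (I ^ m ⊓ J ^ s) 1)) hh
    refine Eq.trans this ?_
    exact one_smul R x
  refine ⟨h.hom (Submodule.mkQ (I ^ m) 1, 0), ⟨m, fun a ha => ?_⟩,
    h.hom (0, -Submodule.mkQ (J ^ s) 1), ⟨s, fun a ha => ?_⟩, ?_⟩
  · rw [← map_smul, Prod.smul_mk, smul_zero, ← map_smul, smul_eq_mul, mul_one]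
    have : Submodule.mkQ (I ^ m) a = 0 := (Submodule.Quotient.mk_eq_zero _).2 ha
    rw [this]
    exact map_zero h.hom
  · rw [← map_smul, Prod.smul_mk, smul_zero, smul_neg, ← map_smul, smul_eq_mul, mul_one]
    have : Submodule.mkQ (J ^ s) a = 0 := (Submodule.Quotient.mk_eq_zero _).2 ha
    rw [this, neg_zero]
    exact map_zero h.hom
  · rw [← map_sub, Prod.mk_sub_mk, sub_zero, zero_sub, neg_neg, hx1]

/-- For a complex of injective modules over a Noetherian ring, the sequence
`0 ⟶ Γ_{I+J}(E) ⟶ Γ_I(E) ⊕ Γ_J(E) ⟶ Γ_{I∩J}(E) ⟶ 0` is exact. -/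
theorem mvShortComplex_shortExact [IsNoetherianRing R] (I J : Ideal R)
    (E : CochainComplex (ModuleCat.{u} R) ℕ) (hE : ∀ j, Injective (E.X j)) :
    (mvShortComplex I J E).ShortExact := by
  refine HomologicalComplex.shortExact_of_degreewise_shortExact _ fun j => ?_
  have := hE j
  refine ShortComplex.ShortExact.mk' ?_ ?_ ?_
  · rw [ShortComplex.moduleCat_exact_iff]
    rintro ⟨y, z⟩ h
    have hyz : (y : E.X j) = z := sub_eq_zero.1 (congrArg Subtype.val h)
    exact ⟨⟨y, torsion_sup I J _ y.2 (hyz ▸ z.2)⟩, Prod.ext rfl (Subtype.ext hyz)⟩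
  · refine (ModuleCat.mono_iff_injective _).2 fun x y h => ?_
    exact Subtype.ext (congrArg (fun p => (p.1 : E.X j)) h)
  · refine (ModuleCat.epi_iff_surjective _).2 fun x => ?_
    obtain ⟨y, hy, z, hz, h⟩ := exists_sub_eq I J (E.X j) x.2
    exact ⟨(⟨y, hy⟩, ⟨z, hz⟩), Subtype.ext h⟩

variable {M : ModuleCat.{u} R} (E : InjectiveResolution M)

/-- The natural map `H^i_{L'}(M) ⟶ H^i_L(M)` for `L ≤ L'`, induced by `Γ_{L'} ⊆ Γ_L`. -/
noncomputable def cohIncl {L L' : Ideal R} (h : L ≤ L') (i : ℕ) :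
    localCoh L' E i →ₗ[R] localCoh L E i :=
  (HomologicalComplex.homologyMap
    ((NatTrans.mapHomologicalComplex (torsionIncl h) (ComplexShape.up ℕ)).app E.cocomplex) i).hom

/-- `ρ^i : H^i_{I+J}(M) ⟶ H^i_I(M) ⊕ H^i_J(M)`, `x ↦ (x, x)`. -/
noncomputable def mvRho (I J : Ideal R) (i : ℕ) :
    localCoh (I ⊔ J) E i →ₗ[R] localCoh I E i × localCoh J E i :=
  (cohIncl E le_sup_left i).prod (cohIncl E le_sup_right i)

/-- `π^i : H^i_I(M) ⊕ H^i_J(M) ⟶ H^i_{I∩J}(M)`, `(x, y) ↦ x - y`. -/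
noncomputable def mvPi (I J : Ideal R) (i : ℕ) :
    localCoh I E i × localCoh J E i →ₗ[R] localCoh (I ⊓ J) E i :=
  (cohIncl E inf_le_left i).comp (LinearMap.fst R _ _) -
    (cohIncl E inf_le_right i).comp (LinearMap.snd R _ _)

/-- `δ^i : H^i_{I∩J}(M) ⟶ H^{i+1}_{I+J}(M)`, the connecting map of the short exact sequence of
complexes `0 ⟶ Γ_{I+J}(E) ⟶ Γ_I(E) ⊕ Γ_J(E) ⟶ Γ_{I∩J}(E) ⟶ 0`. -/
noncomputable def mvDelta [IsNoetherianRing R] (I J : Ideal R) (i : ℕ) :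
    localCoh (I ⊓ J) E i →ₗ[R] localCoh (I ⊔ J) E (i + 1) :=
  ((mvShortComplex_shortExact I J E.cocomplex E.injective).δ i (i + 1) rfl).hom

end LocalCohomology

/-! ### The Weyl algebra -/

section Weyl

open MvPolynomial

variable (K : Type u) [Field K] (n : ℕ)

/-- The `n`-th Weyl algebra `A_n(K)` (for `K` of characteristic zero): the algebra of operators on
`K[X_1, …, X_n]` generated by the multiplications by the `X_i` and the partial derivatives. -/
noncomputable def weylAlgebra : Subalgebra K (Module.End K (MvPolynomial (Fin n) K)) :=
  Algebra.adjoin K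
    (Set.range (fun i : Fin n => LinearMap.mulLeft K (X i : MvPolynomial (Fin n) K)) ∪
      Set.range (fun i : Fin n => ((pderiv i : Derivation K (MvPolynomial (Fin n) K)
        (MvPolynomial (Fin n) K)) : MvPolynomial (Fin n) K →ₗ[K] MvPolynomial (Fin n) K)))

theorem lmul_mem_weylAlgebra (p : MvPolynomial (Fin n) K) :
    Algebra.lmul K (MvPolynomial (Fin n) K) p ∈ weylAlgebra K n := by
  induction p using MvPolynomial.induction_on with
  | C a =>
    have : Algebra.lmul K (MvPolynomial (Fin n) K) (C a) = algebraMap K _ a :=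
      AlgHom.commutes _ a
    rw [this]
    exact Subalgebra.algebraMap_mem _ a
  | add p q hp hq => rw [map_add]; exact add_mem hp hq
  | mul_X p i hp =>
    rw [map_mul]
    exact mul_mem hp (Algebra.subset_adjoin (Or.inl ⟨i, rfl⟩))

/-- The inclusion `K[X_1, …, X_n] → A_n(K)`. -/
noncomputable def toWeyl : MvPolynomial (Fin n) K →+* weylAlgebra K n :=
  ((Algebra.lmul K (MvPolynomial (Fin n) K)).codRestrict (weylAlgebra K n)
    (lmul_mem_weylAlgebra K n)).toRingHom

variable {K n}

theorem pderiv_mem_pow (L : Ideal (MvPolynomial (Fin n) K)) (j : Fin n) (s : ℕ)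
    {a : MvPolynomial (Fin n) K} (ha : a ∈ L ^ (s + 1)) : pderiv j a ∈ L ^ s := by
  induction s generalizing a with
  | zero => simp
  | succ s ih =>
    rw [pow_succ] at ha
    induction ha using Submodule.mul_induction_on' with
    | mem_mul_mem b hb c hc =>
      rw [Derivation.leibniz, smul_eq_mul, smul_eq_mul]
      refine add_mem (Ideal.mul_mem_right _ _ hb) ?_
      rw [mul_comm, pow_succ]
      exact Ideal.mul_mem_mul (ih hb) hc
    | add b _ c _ hb hc => rw [map_add]; exact add_mem hb hc

/-- `Γ_L(N)` of an `A_n(K)`-module `N` is an `A_n(K)`-submodule. -/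
theorem smul_mem_torsion (L : Ideal (MvPolynomial (Fin n) K)) (N : Type u) [AddCommGroup N]
    [Module (weylAlgebra K n) N] (P : weylAlgebra K n) {m : N}
    (hm : ∃ s : ℕ, ∀ a ∈ L ^ s, toWeyl K n a • m = 0) :
    ∃ s : ℕ, ∀ a ∈ L ^ s, toWeyl K n a • P • m = 0 := by
  suffices H : ∀ x ∈ weylAlgebra K n, ∀ Y : weylAlgebra K n, (Y : Module.End K _) = x →
      ∀ m : N, (∃ s : ℕ, ∀ a ∈ L ^ s, toWeyl K n a • m = 0) →
        ∃ s : ℕ, ∀ a ∈ L ^ s, toWeyl K n a • Y • m = 0 from H P P.2 P rfl m hm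
  intro x hx
  induction hx using Algebra.adjoin_induction with
  | mem x hx =>
    rintro Y rfl m ⟨s, hs⟩
    rcases hx with ⟨j, hj⟩ | ⟨j, hj⟩
    · refine ⟨s, fun a ha => ?_⟩
      have e : toWeyl K n a * Y = Y * toWeyl K n a := by
        apply Subtype.ext
        apply LinearMap.ext
        intro p
        change a * Y.1 p = Y.1 (a * p)
        rw [← hj]
        exact mul_left_comm a (X j) p
      rw [← mul_smul, e, mul_smul, hs a ha, smul_zero]
    · refine ⟨s + 1, fun a ha => ?_⟩
      have e : toWeyl K n a * Y + toWeyl K n (pderiv j a) = Y * toWeyl K n a := by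
        apply Subtype.ext
        apply LinearMap.ext
        intro p
        change a * Y.1 p + pderiv j a * p = Y.1 (a * p)
        rw [← hj]
        change a * pderiv j p + pderiv j a * p = pderiv j (a * p)
        rw [Derivation.leibniz, smul_eq_mul, smul_eq_mul]
        ring
      have e' := congrArg (fun Z => Z • m) e
      rw [add_smul, mul_smul, mul_smul, hs a (Ideal.pow_le_pow_right s.le_succ ha),
        hs _ (pderiv_mem_pow L j s ha), smul_zero, add_zero] at e'
      exact e'
  | algebraMap r =>
    rintro Y hY m ⟨s, hs⟩
    refine ⟨s, fun a ha => ?_⟩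
    have e : toWeyl K n a * Y = Y * toWeyl K n a := by
      apply Subtype.ext
      change _ * Y.1 = Y.1 * _
      rw [hY]
      exact (Algebra.commutes r _).symm
    rw [← mul_smul, e, mul_smul, hs a ha, smul_zero]
  | add x y hx hy ihx ihy =>
    intro Y hY m hm
    obtain ⟨s, hs⟩ := ihx ⟨x, hx⟩ rfl m hm
    obtain ⟨t, ht⟩ := ihy ⟨y, hy⟩ rfl m hm
    refine ⟨s + t, fun a ha => ?_⟩
    have e : Y = (⟨x, hx⟩ : weylAlgebra K n) + ⟨y, hy⟩ := Subtype.ext hY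
    rw [e, add_smul, smul_add, hs a (Ideal.pow_le_pow_right (Nat.le_add_right s t) ha),
      ht a (Ideal.pow_le_pow_right (Nat.le_add_left t s) ha), add_zero]
  | mul x y hx hy ihx ihy =>
    intro Y hY m hm
    have e : Y = (⟨x, hx⟩ : weylAlgebra K n) * ⟨y, hy⟩ := Subtype.ext hY
    rw [e, mul_smul]
    exact ihx ⟨x, hx⟩ rfl _ (ihy ⟨y, hy⟩ rfl m hm)

variable (K n) in
/-- Restriction of scalars from `A_n(K)`-modules to `K[X_1, …, X_n]`-modules. -/
noncomputable abbrev weylRes :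
    ModuleCat.{u} (weylAlgebra K n) ⥤ ModuleCat.{u} (MvPolynomial (Fin n) K) :=
  ModuleCat.restrictScalars (toWeyl K n)

instance : (weylRes K n).PreservesHomology :=
  Functor.preservesHomology_of_map_exact _ fun S h => by
    rw [ShortComplex.ShortExact.moduleCat_exact_iff_function_exact] at h ⊢
    exact h

/-- `Γ_L(N)` as an `A_n(K)`-submodule of an `A_n(K)`-module `N`. -/
def weylTorsion (L : Ideal (MvPolynomial (Fin n) K)) (N : ModuleCat.{u} (weylAlgebra K n)) :
    Submodule (weylAlgebra K n) N where
  carrier := {m | ∃ s : ℕ, ∀ a ∈ L ^ s, toWeyl K n a • m = 0}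
  zero_mem' := (torsion L ((weylRes K n).obj N)).zero_mem
  add_mem' hx hy := (torsion L ((weylRes K n).obj N)).add_mem hx hy
  smul_mem' P _ hm := smul_mem_torsion L N P hm

/-- The functor `Γ_L` on `A_n(K)`-modules. -/
noncomputable def weylTorsionFunctor (L : Ideal (MvPolynomial (Fin n) K)) :
    ModuleCat.{u} (weylAlgebra K n) ⥤ ModuleCat.{u} (weylAlgebra K n) where
  obj N := ModuleCat.of _ (weylTorsion L N)
  map f := ModuleCat.ofHom (f.hom.restrict fun _ hm =>
    map_mem_torsion L ((weylRes K n).map f).hom hm)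
  map_id _ := rfl
  map_comp _ _ := rfl

instance (L : Ideal (MvPolynomial (Fin n) K)) : (weylTorsionFunctor L).Additive where
  map_add := rfl

/-- The complex of `A_n(K)`-modules `Γ_L(Q)`, for a cochain complex `Q` of `A_n(K)`-modules. -/
noncomputable abbrev weylTorsionComplex (L : Ideal (MvPolynomial (Fin n) K))
    (Q : CochainComplex (ModuleCat.{u} (weylAlgebra K n)) ℕ) :
    CochainComplex (ModuleCat.{u} (weylAlgebra K n)) ℕ :=
  ((weylTorsionFunctor L).mapHomologicalComplex (ComplexShape.up ℕ)).obj Q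

/-- The complex of `A_n(K)`-modules `Q`, regarded as a complex of `K[X_1, …, X_n]`-modules. -/
noncomputable abbrev weylResComplex (Q : CochainComplex (ModuleCat.{u} (weylAlgebra K n)) ℕ) :
    CochainComplex (ModuleCat.{u} (MvPolynomial (Fin n) K)) ℕ :=
  ((weylRes K n).mapHomologicalComplex (ComplexShape.up ℕ)).obj Q

variable (K n) in
/-- `R = K[X_1, …, X_n]` as a module over itself. -/
noncomputable abbrev polyR : ModuleCat.{u} (MvPolynomial (Fin n) K) :=
  ModuleCat.of _ (MvPolynomial (Fin n) K)

variable (K n) in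
/-- `R = K[X_1, …, X_n]` as a module over `A_n(K)`, differential operators acting on
polynomials. -/
noncomputable abbrev polyD : ModuleCat.{u} (weylAlgebra K n) :=
  ModuleCat.of _ (MvPolynomial (Fin n) K)

/-- Given a resolution `Q` of `R` by injective `A_n(K)`-modules and a resolution `E` of `R` by
injective `R`-modules, an `R`-linear chain map `Q ⟶ E` is a comparison map if it lifts the
identity of `R`. -/
def IsComparison (Q : InjectiveResolution (polyD K n)) (E : InjectiveResolution (polyR K n))
    (c : weylResComplex Q.cocomplex ⟶ E.cocomplex) : Prop :=
  ∀ r : MvPolynomial (Fin n) K,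
    (c.f 0).hom ((Q.ι.f 0).hom r : Q.cocomplex.X 0) = (E.ι.f 0).hom r

/-- The chain map `Γ_L(Q) ⟶ Γ_L(E)` obtained from `c : Q ⟶ E` by restriction. -/
noncomputable def torsionComparison (L : Ideal (MvPolynomial (Fin n) K))
    {Q : CochainComplex (ModuleCat.{u} (weylAlgebra K n)) ℕ}
    {E : CochainComplex (ModuleCat.{u} (MvPolynomial (Fin n) K)) ℕ}
    (c : weylResComplex Q ⟶ E) :
    weylResComplex (weylTorsionComplex L Q) ⟶ torsionComplex L E where
  f j := ModuleCat.ofHom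
    (X := (weylRes K n).obj ((weylTorsionFunctor L).obj (Q.X j)))
    { toFun := fun x => ⟨(c.f j).hom x.1, map_mem_torsion L (c.f j).hom x.2⟩
      map_add' := fun x y => Subtype.ext (map_add (c.f j).hom x.1 y.1)
      map_smul' := fun r x => Subtype.ext
        (map_smul (c.f j).hom r (show (weylRes K n).obj (Q.X j) from x.1)) }
  comm' j k _ := by
    ext x
    apply Subtype.ext
    exact congrArg (fun f => f.hom x.1) (c.comm j k)

/-- The `R`-linear map `H^i(Γ_L(Q)) ⟶ H^i(Γ_L(E)) = H^i_L(R)` induced by a chain map `Q ⟶ E`;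
the source is an `A_n(K)`-module. -/
noncomputable def cohComparison (L : Ideal (MvPolynomial (Fin n) K))
    {Q : InjectiveResolution (polyD K n)} {E : InjectiveResolution (polyR K n)}
    (c : weylResComplex Q.cocomplex ⟶ E.cocomplex) (i : ℕ) :
    (weylRes K n).obj ((weylTorsionComplex L Q.cocomplex).homology i) ⟶ localCoh L E i :=
  (((weylTorsionComplex L Q.cocomplex).sc i).mapHomologyIso (weylRes K n)).inv ≫
    HomologicalComplex.homologyMap (torsionComparison L c) i

end Weyl

end MVWeyl

/-!
Sending `∑ r_α ξ^α` to the operator `∑ ∂^α r_α` identifies `K[X][ξ]` with `A_n(K)` as a right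
`K[X]`-module. Indeed `[-, X_i]` corresponds to `∂/∂ξ_i`, so the kernel is stable under
the derivatives in `ξ`; in characteristic zero a nonzero element of it would yield a nonzero
constant in the kernel, which is absurd. Hence `A_n(K)` is flat as a right `K[X]`-module, the
extension of scalars is exact, and its right adjoint, the restriction of scalars, preserves
injectives.

A resolution `Q` of `R` by injective `A_n(K)`-modules is therefore also one by injective
`R`-modules, and any comparison map `Q ⟶ E` induces bijections `H^i(Γ_L(Q)) ⟶ H^i_L(R)`, along which
the `A_n(K)`-structure is transported. Comparison maps are unique up to homotopy, so the structure
does not depend on the choices. The Mayer–Vietoris sequence of `Q` lives in `A_n(K)`-modules, and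
`Q ⟶ E` maps it to that of `E`, connecting maps included, because the restriction of scalars is
exact.
-/

namespace MVWeyl

section RightRestriction

open TensorProduct

variable {R A : Type u} [CommRing R] [Ring A]

/-- The ring `A` as a right `R`-module along `φ : R →+* A`. As `R` is commutative, the right action
is encoded as the module structure `r • a = a * φ r`; it commutes with left multiplication. -/
def RightRestriction (_ : R →+* A) : Type u := A

namespace RightRestriction

variable (φ : R →+* A)

instance : Ring (RightRestriction φ) := inferInstanceAs (Ring A)

instance : Module A (RightRestriction φ) := inferInstanceAs (Module A A)

instance : Module R (RightRestriction φ) :=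
  Module.compHom A (φ.toOpposite fun r s => (Commute.all r s).map φ)

instance : SMulCommClass R A (RightRestriction φ) where
  smul_comm r a b := mul_assoc a (show A from b) (φ r)

instance : SMulCommClass A R (RightRestriction φ) := .symm _ _ _

theorem smul_one (r : R) : r • (1 : RightRestriction φ) = φ r • (1 : RightRestriction φ) :=
  (one_mul (φ r)).trans (mul_one (φ r)).symm

variable {φ} {X Y N : Type u} [AddCommGroup X] [Module R X] [AddCommGroup Y] [Module R Y]
  [AddCommGroup N] [Module A N]

/-- The `A`-linear map `A ⊗ X → N`, `a ⊗ x ↦ a • f x`, from the extension of scalars of the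
`R`-module `X` that corresponds to a `φ`-semilinear map `f` into the `A`-module `N`. -/
def tensorLift (f : X →ₛₗ[φ] N) : RightRestriction φ ⊗[R] X →ₗ[A] N where
  toAddHom := (liftAddHom (R := R) (M := RightRestriction φ)
    ((smulAddHom A N).compl₂ f.toAddMonoidHom) fun r a x =>
      ((mul_smul (show A from a) (φ r) (f x)).trans
      (congrArg ((show A from a) • ·) (f.map_smulₛₗ r x).symm))).toAddHom
  map_smul' a t := by
    induction t using TensorProduct.induction_on with
    | zero => simp
    | tmul b x => exact mul_smul a (show A from b) (f x)
    | add s t hs ht => rw [smul_add]; simp_all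

theorem tensorLift_one_tmul (f : X →ₛₗ[φ] N) (x : X) : tensorLift f (1 ⊗ₜ x) = f x :=
  one_smul A (f x)

/-- The unit `X → A ⊗ X`, `x ↦ 1 ⊗ x`, of the extension of scalars along `φ`. -/
def oneTMul : X →ₛₗ[φ] RightRestriction φ ⊗[R] X where
  toFun x := 1 ⊗ₜ x
  map_add' := tmul_add _
  map_smul' r x := by rw [← smul_tmul, smul_tmul', smul_one]

theorem exists_linearMap_eq_lTensor (B : Type u) [AddCommGroup B] [Module R B] [Module A B]
    [SMulCommClass R A B] (j : X →ₗ[R] Y) : ∃ J : B ⊗[R] X →ₗ[A] B ⊗[R] Y, ⇑J = j.lTensor B :=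
  ⟨{ j.lTensor B with
    map_smul' a t := by
      induction t using TensorProduct.induction_on with
      | zero => simp
      | tmul b x => rfl
      | add s t hs ht => simp_all }, rfl⟩

theorem exists_semilinearMap_extension [Module.Flat R (RightRestriction φ)] [Module.Injective A N]
    {j : X →ₗ[R] Y} (hj : Function.Injective j) (f : X →ₛₗ[φ] N) :
    ∃ g : Y →ₛₗ[φ] N, ∀ x, g (j x) = f x := by
  obtain ⟨J, hJ⟩ := exists_linearMap_eq_lTensor (A := A) (RightRestriction φ) j
  obtain ⟨g, hg⟩ := Module.Injective.out J
    (hJ ▸ Module.Flat.lTensor_preserves_injective_linearMap j hj) (tensorLift f)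
  refine ⟨g.comp oneTMul, fun x => ?_⟩
  calc g (1 ⊗ₜ j x) = g (J (1 ⊗ₜ x)) := by rw [hJ, LinearMap.lTensor_tmul]
    _ = f x := by rw [hg, tensorLift_one_tmul]

end RightRestriction

instance (φ : R →+* A) [Module.Flat R (RightRestriction φ)] :
    (ModuleCat.restrictScalars.{u} φ).PreservesInjectiveObjects where
  injective_obj {N} _ := ⟨fun {X Y} f j _ => by
    have : Module.Injective A N := (Module.injective_iff_injective_object A N).2 ‹_›
    obtain ⟨g, hg⟩ := RightRestriction.exists_semilinearMap_extension (N := N)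
      ((ModuleCat.mono_iff_injective j).1 ‹_›) { f.hom with map_smul' := map_smul f.hom }
    exact ⟨ModuleCat.ofHom (Y := (ModuleCat.restrictScalars φ).obj N)
      { g with map_smul' := g.map_smulₛₗ }, ModuleCat.hom_ext (LinearMap.ext hg)⟩⟩

end RightRestriction

section PolynomialDerivatives

open MvPolynomial

section AevalOfCommute

variable {k A σ : Type*} [CommRing k] [Ring A] [Algebra k A] {x : σ → A}

open scoped IsMulCommutative in
/-- Evaluation of polynomials at pairwise commuting elements of a possibly noncommutative
algebra. -/
noncomputable def aevalOfCommute (hx : ∀ i j, Commute (x i) (x j)) : MvPolynomial σ k →ₐ[k] A :=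
  have := Algebra.isMulCommutative_adjoin k (s := Set.range x) (by
    rintro _ ⟨i, rfl⟩ _ ⟨j, rfl⟩
    exact hx i j)
  (Algebra.adjoin k (Set.range x)).val.comp
    (aeval fun i => ⟨x i, Algebra.subset_adjoin ⟨i, rfl⟩⟩)

theorem aevalOfCommute_X (hx : ∀ i j, Commute (x i) (x j)) (i : σ) :
    aevalOfCommute (k := k) hx (X i) = x i := by
  simp [aevalOfCommute]

end AevalOfCommute

theorem pderiv_comm {σ k : Type*} [CommRing k] (i j : σ) (p : MvPolynomial σ k) :
    pderiv i (pderiv j p) = pderiv j (pderiv i p) := by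
  have h : ⁅(pderiv i : Derivation k (MvPolynomial σ k) (MvPolynomial σ k)),
      (pderiv j : Derivation k (MvPolynomial σ k) (MvPolynomial σ k))⁆ = 0 := by
    classical
    refine derivation_ext fun l => ?_
    rw [Derivation.commutator_apply]
    simp only [pderiv_X, Pi.single_apply]
    split_ifs <;> simp
  have := DFunLike.congr_fun h p
  rwa [Derivation.commutator_apply, Derivation.zero_apply, sub_eq_zero] at this

variable {σ k : Type*} [CommSemiring k]

theorem totalDegree_pderiv_lt {p : MvPolynomial σ k} (hp : p.totalDegree ≠ 0) (i : σ) :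
    (pderiv i p).totalDegree < p.totalDegree := by
  refine (Finset.sup_lt_iff (Nat.pos_of_ne_zero hp)).2 fun α hα => ?_
  have hα' : α + Finsupp.single i 1 ∈ p.support := by
    rw [mem_support_iff, coeff_pderiv] at hα
    exact mem_support_iff.2 (left_ne_zero_of_mul hα)
  have h := le_totalDegree hα'
  rw [Finsupp.sum_add_index' (fun _ => rfl) (fun _ _ _ => rfl), Finsupp.sum_single_index rfl] at h
  exact h

variable [NoZeroDivisors k] [CharZero k]

theorem eq_C_of_pderiv_eq_zero {p : MvPolynomial σ k} (hp : ∀ i, pderiv i p = 0) :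
    p = C (p.coeff 0) := by
  classical
  ext α
  rw [coeff_C]
  split_ifs with hα
  · rw [hα]
  obtain ⟨i, hi⟩ := Finsupp.ne_iff.1 (Ne.symm hα)
  have h := coeff_pderiv (i := i) p (α - Finsupp.single i 1)
  rw [hp, coeff_zero, tsub_add_cancel_of_le
    (Finsupp.single_le_iff.2 (Nat.one_le_iff_ne_zero.2 hi))] at h
  exact (mul_eq_zero.1 h.symm).resolve_right (Nat.cast_add_one_ne_zero _)

theorem eq_zero_of_mem_of_pderiv_mem {S : Set (MvPolynomial σ k)}
    (hS : ∀ p ∈ S, ∀ i, pderiv i p ∈ S) (hC : ∀ a, C a ∈ S → a = 0) {p : MvPolynomial σ k}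
    (hp : p ∈ S) : p = 0 := by
  induction hN : p.totalDegree using Nat.strong_induction_on generalizing p with
  | _ N ih =>
    have hpC : p = C (p.coeff 0) := by
      by_cases h0 : p.totalDegree = 0
      · exact totalDegree_eq_zero_iff_eq_C.1 h0
      · exact eq_C_of_pderiv_eq_zero fun i =>
          ih _ (hN ▸ totalDegree_pderiv_lt h0 i) (hS p hp i) rfl
    exact hpC.trans ((congrArg C (hC _ (hpC ▸ hp))).trans C_0)

end PolynomialDerivatives

section WeylFreeness

open MvPolynomial

variable {K : Type u} [Field K] {n : ℕ}

variable (K) in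
/-- The partial derivative `∂_i`, as an element of the Weyl algebra. -/
noncomputable def weylD (i : Fin n) : weylAlgebra K n :=
  ⟨(pderiv i : Derivation K (MvPolynomial (Fin n) K) (MvPolynomial (Fin n) K)),
    Algebra.subset_adjoin (Or.inr ⟨i, rfl⟩)⟩

theorem weylAlgebra_ext {P Q : weylAlgebra K n} (h : ∀ p, P.1 p = Q.1 p) : P = Q :=
  Subtype.ext (LinearMap.ext h)

theorem weylD_mul_toWeyl (i : Fin n) (r : MvPolynomial (Fin n) K) :
    weylD K i * toWeyl K n r = toWeyl K n r * weylD K i + toWeyl K n (pderiv i r) := by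
  refine weylAlgebra_ext fun p => ?_
  change pderiv i (r * p) = r * pderiv i p + pderiv i r * p
  rw [pderiv_mul, add_comm]

theorem weylD_commute (i j : Fin n) : Commute (weylD K i) (weylD K j) :=
  weylAlgebra_ext (pderiv_comm i j)

theorem toWeyl_C (a : K) : toWeyl K n (C a) = algebraMap K _ a :=
  weylAlgebra_ext fun p => (Algebra.smul_def a p).symm

theorem toWeyl_injective : Function.Injective (toWeyl K n) := fun r s h => by
  have h1 := congrArg (fun P => P.1 (1 : MvPolynomial (Fin n) K)) h
  exact (mul_one r).symm.trans (h1.trans (mul_one s))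

theorem weylAlgebra_induction {motive : weylAlgebra K n → Prop}
    (toWeyl_X : ∀ i, motive (toWeyl K n (X i))) (weylD : ∀ i, motive (weylD K i))
    (algebraMap : ∀ a, motive (algebraMap K _ a))
    (add : ∀ P Q, motive P → motive Q → motive (P + Q))
    (mul : ∀ P Q, motive P → motive Q → motive (P * Q)) (P : weylAlgebra K n) : motive P := by
  obtain ⟨P, hP⟩ := P
  induction hP using Algebra.adjoin_induction with
  | mem P hP =>
    rcases hP with ⟨i, rfl⟩ | ⟨i, rfl⟩
    · exact toWeyl_X i
    · exact weylD i
  | algebraMap a => exact algebraMap a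
  | add P Q _ _ hP hQ => exact add _ _ hP hQ
  | mul P Q _ _ hP hQ => exact mul _ _ hP hQ

variable (K n) in
/-- `A_n(K)` as a right `K[X_1, …, X_n]`-module. -/
abbrev WeylRight : Type u :=
  RightRestriction (R := MvPolynomial (Fin n) K) (A := weylAlgebra K n) (toWeyl K n)

variable (K n) in
/-- The action of right symbols, the polynomials in `ξ_1, …, ξ_n` with coefficients in
`K[X_1, …, X_n]`, on `A_n(K)`: coefficients multiply on the right, `ξ_i` acts as left
multiplication by `∂_i`. -/
noncomputable def symbolAction : MvPolynomial (Fin n) (MvPolynomial (Fin n) K)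
    →ₐ[MvPolynomial (Fin n) K] Module.End (MvPolynomial (Fin n) K) (WeylRight K n) :=
  aevalOfCommute fun i j => (weylD_commute (K := K) i j).map
    (Module.toModuleEnd (MvPolynomial (Fin n) K) (S := weylAlgebra K n) (WeylRight K n))

variable (K n) in
/-- The operator `∑ ∂^α r_α` with right symbol `∑ r_α ξ^α`. -/
noncomputable def ofRightSymbol : MvPolynomial (Fin n) (MvPolynomial (Fin n) K)
    →ₗ[MvPolynomial (Fin n) K] WeylRight K n :=
  (LinearMap.applyₗ 1).comp (symbolAction K n).toLinearMap

theorem ofRightSymbol_C (r : MvPolynomial (Fin n) K) : ofRightSymbol K n (C r) = r • 1 :=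
  DFunLike.congr_fun ((symbolAction K n).commutes r) 1

theorem ofRightSymbol_mul_X (F : MvPolynomial (Fin n) (MvPolynomial (Fin n) K)) (i : Fin n) :
    ofRightSymbol K n (F * X i) = weylD K i • ofRightSymbol K n F := by
  rw [mul_comm]
  refine (DFunLike.congr_fun (map_mul (symbolAction K n) (X i) F) 1).trans ?_
  rw [symbolAction, aevalOfCommute_X]
  rfl

theorem X_smul_ofRightSymbol (i : Fin n) (F : MvPolynomial (Fin n) (MvPolynomial (Fin n) K)) :
    (X i : MvPolynomial (Fin n) K) • ofRightSymbol K n F =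
      toWeyl K n (X i) • ofRightSymbol K n F + ofRightSymbol K n (pderiv i F) := by
  induction F using MvPolynomial.induction_on with
  | C r =>
    rw [ofRightSymbol_C, pderiv_C, map_zero, add_zero, smul_comm _ r,
      RightRestriction.smul_one, smul_comm r]
  | add F G hF hG =>
    simp only [map_add, smul_add, hF, hG]
    abel
  | mul_X F j hF =>
    have hX : toWeyl K n (pderiv j (X i)) • ofRightSymbol K n F =
        ofRightSymbol K n (F * pderiv i (X j)) := by
      obtain rfl | hij := eq_or_ne i j
      · rw [pderiv_X_self, pderiv_X_self, map_one, one_smul, mul_one]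
      · rw [pderiv_X_of_ne hij, pderiv_X_of_ne hij.symm, map_zero, zero_smul, mul_zero, map_zero]
    rw [pderiv_mul, map_add, ← hX, ofRightSymbol_mul_X, ofRightSymbol_mul_X, smul_comm, hF,
      smul_add, ← mul_smul, weylD_mul_toWeyl, add_smul, mul_smul]
    abel

theorem ofRightSymbol_surjective : Function.Surjective (ofRightSymbol K n) := by
  suffices h : ∀ P : weylAlgebra K n, ∀ F, ∃ G, ofRightSymbol K n G = P • ofRightSymbol K n F by
    intro P
    obtain ⟨G, hG⟩ := h P (C 1)
    refine ⟨G, hG.trans ?_⟩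
    rw [ofRightSymbol_C, one_smul]
    exact mul_one (M := weylAlgebra K n) P
  intro P
  induction P using weylAlgebra_induction with
  | toWeyl_X i =>
    exact fun F => ⟨X i • F - pderiv i F, by
      rw [map_sub, map_smul, X_smul_ofRightSymbol, add_sub_cancel_right]⟩
  | weylD i => exact fun F => ⟨F * X i, ofRightSymbol_mul_X F i⟩
  | algebraMap a => exact fun F => ⟨C a • F, by
      rw [map_smul]
      exact (congrArg (ofRightSymbol K n F * ·) (toWeyl_C a)).trans
        (Algebra.commutes (R := K) (A := weylAlgebra K n) a (ofRightSymbol K n F)).symm⟩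
  | add P Q hP hQ =>
    intro F
    obtain ⟨G, hG⟩ := hP F
    obtain ⟨H, hH⟩ := hQ F
    exact ⟨G + H, by rw [map_add, hG, hH, add_smul]⟩
  | mul P Q hP hQ =>
    intro F
    obtain ⟨G, hG⟩ := hQ F
    obtain ⟨H, hH⟩ := hP G
    exact ⟨H, by rw [hH, hG, mul_smul]⟩

variable [CharZero K]

theorem ofRightSymbol_injective : Function.Injective (ofRightSymbol K n) := by
  refine (injective_iff_map_eq_zero _).2 fun F hF => ?_
  refine eq_zero_of_mem_of_pderiv_mem (S := {F | ofRightSymbol K n F = 0}) (fun G hG i => ?_)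
    (fun r hr => ?_) hF
  · have h := X_smul_ofRightSymbol i G
    rw [Set.mem_ofPred.1 hG, smul_zero, smul_zero, zero_add] at h
    exact h.symm
  · refine (map_eq_zero_iff _ toWeyl_injective).1 ?_
    rw [Set.mem_ofPred, ofRightSymbol_C] at hr
    exact (one_mul (toWeyl K n r)).symm.trans hr

instance : Module.Free (MvPolynomial (Fin n) K) (WeylRight K n) :=
  .of_equiv (.ofBijective (ofRightSymbol K n) ⟨ofRightSymbol_injective, ofRightSymbol_surjective⟩)

end WeylFreeness

section ExactFunctor

variable {C D : Type*} [Category* C] [Category* D] [Abelian C] [Abelian D] (F : C ⥤ D)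
  [F.Additive] [F.PreservesHomology]

theorem map_homologyπ_mapHomologyIso_inv (S : ShortComplex C) :
    F.map S.homologyπ ≫ (S.mapHomologyIso F).inv =
      (S.mapCyclesIso F).inv ≫ (S.map F).homologyπ := by
  let H := S.leftHomologyData
  let eH : (S.map F).homology ≅ F.obj H.H := (H.map F).homologyIso
  let eK : (S.map F).cycles ≅ F.obj H.K := (H.map F).cyclesIso
  have hπ : (S.map F).homologyπ ≫ eH.hom = eK.hom ≫ F.map H.π :=
    (H.map F).homologyπ_comp_homologyIso_hom
  have heH : S.mapHomologyIso F = eH ≪≫ F.mapIso H.homologyIso.symm := H.mapHomologyIso_eq F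
  have heK : S.mapCyclesIso F = eK ≪≫ F.mapIso H.cyclesIso.symm := H.mapCyclesIso_eq F
  rw [Iso.eq_inv_comp, ← Category.assoc, Iso.comp_inv_eq, heH, heK]
  simp only [Iso.trans_hom, Functor.mapIso_hom, Iso.symm_hom, Category.assoc, reassoc_of% hπ]
  rw [← F.map_comp, ← F.map_comp, H.π_comp_homologyIso_inv]

variable {ι : Type*} {c : ComplexShape ι}

/-- The isomorphism `F (Z^i X) ≅ Z^i (F X)` for an exact functor `F`. -/
noncomputable def mapComplexCyclesIso (X : HomologicalComplex C c) (i : ι) :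
    F.obj (X.cycles i) ≅ ((F.mapHomologicalComplex c).obj X).cycles i :=
  ((X.sc i).mapCyclesIso F).symm

/-- The isomorphism `F (H^i X) ≅ H^i (F X)` for an exact functor `F`. -/
noncomputable def mapComplexHomologyIso (X : HomologicalComplex C c) (i : ι) :
    F.obj (X.homology i) ≅ ((F.mapHomologicalComplex c).obj X).homology i :=
  ((X.sc i).mapHomologyIso F).symm

theorem mapComplexHomologyIso_hom_naturality {X Y : HomologicalComplex C c} (f : X ⟶ Y) (i : ι) :
    F.map (HomologicalComplex.homologyMap f i) ≫ (mapComplexHomologyIso F Y i).hom =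
      (mapComplexHomologyIso F X i).hom ≫
        HomologicalComplex.homologyMap ((F.mapHomologicalComplex c).map f) i :=
  ShortComplex.mapHomologyIso_inv_naturality
    ((HomologicalComplex.shortComplexFunctor C c i).map f) F

theorem mapComplexCyclesIso_hom_iCycles (X : HomologicalComplex C c) (i : ι) :
    (mapComplexCyclesIso F X i).hom ≫ ((F.mapHomologicalComplex c).obj X).iCycles i =
      F.map (X.iCycles i) :=
  (Iso.inv_comp_eq _).2 ((X.sc i).mapCyclesIso_hom_iCycles F).symm

theorem map_homologyπ_mapComplexHomologyIso_hom (X : HomologicalComplex C c) (i : ι) :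
    F.map (X.homologyπ i) ≫ (mapComplexHomologyIso F X i).hom =
      (mapComplexCyclesIso F X i).hom ≫ ((F.mapHomologicalComplex c).obj X).homologyπ i :=
  map_homologyπ_mapHomologyIso_inv F (X.sc i)

theorem map_liftCycles_homologyπ {X : HomologicalComplex C c} {i j : ι} {A : C} (x : A ⟶ X.X i)
    (hj : c.next i = j) (hx : x ≫ X.d i j = 0) (hFx : F.map x ≫ F.map (X.d i j) = 0) :
    F.map (X.liftCycles x j hj hx ≫ X.homologyπ i) ≫ (mapComplexHomologyIso F X i).hom =
      ((F.mapHomologicalComplex c).obj X).liftCycles (F.map x) j hj hFx ≫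
        ((F.mapHomologicalComplex c).obj X).homologyπ i := by
  have hcycles : F.map (X.liftCycles x j hj hx) ≫ (mapComplexCyclesIso F X i).hom =
      ((F.mapHomologicalComplex c).obj X).liftCycles (F.map x) j hj hFx := by
    rw [← cancel_mono (((F.mapHomologicalComplex c).obj X).iCycles i), Category.assoc,
      mapComplexCyclesIso_hom_iCycles]
    have hlift : F.map (X.liftCycles x j hj hx) ≫ F.map (X.iCycles i) = F.map x := by
      rw [← F.map_comp, X.liftCycles_i]
    exact hlift.trans
      (((F.mapHomologicalComplex c).obj X).liftCycles_i (F.map x) j hj hFx).symm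
  rw [F.map_comp, Category.assoc, map_homologyπ_mapComplexHomologyIso_hom, reassoc_of% hcycles]

theorem exists_epi_cycles_lift {S : ShortComplex (HomologicalComplex C c)} (hS : S.ShortExact)
    (i j : ι) :
    ∃ (A : C) (p : A ⟶ S.X₃.cycles i) (_ : Epi p) (x₂ : A ⟶ S.X₂.X i) (x₁ : A ⟶ S.X₁.X j),
      x₂ ≫ S.g.f i = p ≫ S.X₃.iCycles i ∧ x₁ ≫ S.f.f j = x₂ ≫ S.X₂.d i j := by
  have := hS.epi_g
  have := hS.mono_f
  obtain ⟨A, p, hp, x₂, hx₂⟩ := surjective_up_to_refinements_of_epi (S.g.f i) (S.X₃.iCycles i)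
  have hx₂d : (x₂ ≫ S.X₂.d i j) ≫ S.g.f j = 0 := by
    rw [Category.assoc, ← S.g.comm, ← reassoc_of% hx₂, HomologicalComplex.iCycles_d,
      Limits.comp_zero]
  have hexact : (S.map (HomologicalComplex.eval C c j)).Exact := hS.exact.map _
  have : Mono (S.map (HomologicalComplex.eval C c j)).f := inferInstanceAs (Mono (S.f.f j))
  exact ⟨A, p, hp, x₂, hexact.lift (x₂ ≫ S.X₂.d i j) hx₂d, hx₂.symm, hexact.lift_f _ _⟩

theorem shortExact_map_mapHomologicalComplex {S : ShortComplex (HomologicalComplex C c)}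
    (hS : S.ShortExact) : (S.map (F.mapHomologicalComplex c)).ShortExact :=
  HomologicalComplex.shortExact_of_degreewise_shortExact _ fun j =>
    have hSj := hS.map_of_exact (HomologicalComplex.eval C c j)
    have := F.preservesFiniteLimits_of_preservesHomology
    have := F.preservesFiniteColimits_of_preservesHomology
    hSj.map_of_exact F

theorem map_δ_mapComplexHomologyIso_hom {S : ShortComplex (HomologicalComplex C c)}
    (hS : S.ShortExact) (i j : ι) (hij : c.Rel i j) :
    F.map (hS.δ i j hij) ≫ (mapComplexHomologyIso F S.X₁ j).hom =
      (mapComplexHomologyIso F S.X₃ i).hom ≫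
        (shortExact_map_mapHomologicalComplex F hS).δ i j hij := by
  obtain ⟨A, p, hp, x₂, x₁, hx₂, hx₁⟩ := exists_epi_cycles_lift hS i j
  have hx₃ : (p ≫ S.X₃.iCycles i) ≫ S.X₃.d i j = 0 := by
    rw [Category.assoc, HomologicalComplex.iCycles_d, Limits.comp_zero]
  have hp_lift : S.X₃.liftCycles (p ≫ S.X₃.iCycles i) j (c.next_eq' hij) hx₃ = p := by
    rw [← cancel_mono (S.X₃.iCycles i), HomologicalComplex.liftCycles_i]
  have map_comp_eq_zero {X Y Z : C} {f : X ⟶ Y} {g : Y ⟶ Z} (h : f ≫ g = 0) :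
      F.map f ≫ F.map g = 0 := by rw [← F.map_comp, h, F.map_zero]
  have hδ := hS.δ_eq i j hij _ hx₃ x₂ hx₂ x₁ hx₁ _ rfl
  have hFδ := (shortExact_map_mapHomologicalComplex F hS).δ_eq i j hij
    (F.map (p ≫ S.X₃.iCycles i)) (map_comp_eq_zero hx₃) (F.map x₂)
    ((F.map_comp _ _).symm.trans (congrArg F.map hx₂)) (F.map x₁)
    (((F.map_comp _ _).symm.trans (congrArg F.map hx₁)).trans (F.map_comp _ _)) _ rfl
  have h₃ := map_liftCycles_homologyπ F _ (c.next_eq' hij) hx₃ (map_comp_eq_zero hx₃)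
  have hx₁d : x₁ ≫ S.X₁.d j (c.next j) = 0 := by
    have := hS.mono_f
    rw [← cancel_mono (S.f.f _), Category.assoc, ← S.f.comm, reassoc_of% hx₁,
      HomologicalComplex.d_comp_d, Limits.comp_zero, Limits.zero_comp]
  have h₁ := map_liftCycles_homologyπ F x₁ rfl hx₁d (map_comp_eq_zero hx₁d)
  -- As `(S.map _).X₃` is not syntactically `_.obj S.X₃`, one cannot rewrite with `hFδ` itself.
  suffices h : ∀ δ : ((F.mapHomologicalComplex c).obj S.X₃).homology i ⟶
      ((F.mapHomologicalComplex c).obj S.X₁).homology j,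
      HomologicalComplex.liftCycles _ _ j (c.next_eq' hij) (map_comp_eq_zero hx₃) ≫
          HomologicalComplex.homologyπ _ i ≫ δ =
        HomologicalComplex.liftCycles _ _ _ rfl (map_comp_eq_zero hx₁d) ≫
          HomologicalComplex.homologyπ _ j →
      F.map (hS.δ i j hij) ≫ (mapComplexHomologyIso F S.X₁ j).hom =
        (mapComplexHomologyIso F S.X₃ i).hom ≫ δ from h _ hFδ
  intro δ hFδ
  rw [hp_lift] at hδ h₃
  rw [← cancel_epi (F.map (p ≫ S.X₃.homologyπ i)), ← F.map_comp_assoc, Category.assoc, hδ,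
    ← Category.assoc (F.map _), h₃, h₁, Category.assoc, hFδ]

end ExactFunctor

section ExactFunctorResolution

variable {C D : Type*} [Category* C] [Category* D] [Abelian C] [Abelian D] (F : C ⥤ D)
  [F.Additive] [F.PreservesHomology] [F.PreservesInjectiveObjects]

/-- The image of an injective resolution of `X` under an exact functor `F` that preserves
injectives, as an injective resolution of any `Y ≅ F X`. -/
noncomputable def mapInjectiveResolution {X : C} {Y : D} (e : Y ≅ F.obj X)
    (I : InjectiveResolution X) : InjectiveResolution Y where
  cocomplex := (F.mapHomologicalComplex (ComplexShape.up ℕ)).obj I.cocomplex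
  injective j := inferInstanceAs (Injective (F.obj (I.cocomplex.X j)))
  ι := (CochainComplex.single₀ D).map e.hom ≫
    (HomologicalComplex.singleMapHomologicalComplex F (ComplexShape.up ℕ) 0).inv.app X ≫
      (F.mapHomologicalComplex (ComplexShape.up ℕ)).map I.ι
  quasiIso := inferInstance

theorem mapInjectiveResolution_ι_f_zero {X : C} {Y : D} (e : Y ≅ F.obj X)
    (I : InjectiveResolution X) :
    (mapInjectiveResolution F e I).ι.f 0 = e.hom ≫ F.map (I.ι.f 0) := by
  have hinv : ((HomologicalComplex.singleMapHomologicalComplex F (ComplexShape.up ℕ) 0).inv.app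
      X).f 0 = 𝟙 (F.obj X) :=
    (HomologicalComplex.singleMapHomologicalComplex_inv_app_self F _ 0 X).trans
      ((Category.id_comp _).trans (F.map_id X))
  exact congrArg₂ (· ≫ ·) (CochainComplex.single₀_map_f_zero e.hom)
    ((congrArg (· ≫ F.map (I.ι.f 0)) hinv).trans (Category.id_comp _))

end ExactFunctorResolution

section Comparison

variable {K : Type u} [Field K] {n : ℕ}

variable (K n) in
/-- `R` as a module over itself is the restriction of `R` as an `A_n(K)`-module: multiplication
operators act on polynomials by multiplication, definitionally. -/
noncomputable def polyIso : polyR K n ≅ (weylRes K n).obj (polyD K n) :=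
  Iso.refl (polyR K n)

instance [CharZero K] : (weylRes K n).PreservesInjectiveObjects :=
  have : Module.Flat (MvPolynomial (Fin n) K) (WeylRight K n) := inferInstance
  inferInstanceAs (ModuleCat.restrictScalars
    (R := MvPolynomial (Fin n) K) (S := weylAlgebra K n) (toWeyl K n)).PreservesInjectiveObjects

variable {Q Q' : InjectiveResolution (polyD K n)} {E : InjectiveResolution (polyR K n)}

theorem isComparison_iff [CharZero K] (c : weylResComplex Q.cocomplex ⟶ E.cocomplex) :
    IsComparison Q E c ↔
      (mapInjectiveResolution (weylRes K n) (polyIso K n) Q).ι ≫ c = E.ι := by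
  have hι : (mapInjectiveResolution (weylRes K n) (polyIso K n) Q).ι.f 0 =
      (polyIso K n).hom ≫ (weylRes K n).map (Q.ι.f 0) :=
    mapInjectiveResolution_ι_f_zero _ _ _
  constructor
  · intro h
    refine HomologicalComplex.from_single_hom_ext ?_
    refine (congrArg (· ≫ c.f 0) hι).trans (ModuleCat.hom_ext (LinearMap.ext h))
  · intro h r
    have h₀ : ((polyIso K n).hom ≫ (weylRes K n).map (Q.ι.f 0)) ≫ c.f 0 = E.ι.f 0 :=
      (congrArg (· ≫ c.f 0) hι).symm.trans (congrArg (fun f => f.f 0) h)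
    exact congrArg (fun f => f.hom r) h₀

end Comparison

section Torsion
variable {K : Type u} [Field K] {n : ℕ}

theorem weylTorsion_anti {L L' : Ideal (MvPolynomial (Fin n) K)} (h : L ≤ L')
    (N : ModuleCat.{u} (weylAlgebra K n)) : weylTorsion L' N ≤ weylTorsion L N :=
  fun _ hx => torsion_anti h ((weylRes K n).obj N) hx

/-- The inclusion `Γ_{L'} ⟶ Γ_L` for `L ≤ L'`, on `A_n(K)`-modules. -/
noncomputable def weylTorsionIncl {L L' : Ideal (MvPolynomial (Fin n) K)} (h : L ≤ L') :
    weylTorsionFunctor L' ⟶ weylTorsionFunctor L where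
  app N := ModuleCat.ofHom (Submodule.inclusion (weylTorsion_anti h N))
  naturality _ _ _ := rfl

variable (I J : Ideal (MvPolynomial (Fin n) K))

/-- The functor `N ↦ Γ_I(N) × Γ_J(N)` on `A_n(K)`-modules. -/
noncomputable def weylTorsionProd :
    ModuleCat.{u} (weylAlgebra K n) ⥤ ModuleCat.{u} (weylAlgebra K n) where
  obj N := ModuleCat.of _ (weylTorsion I N × weylTorsion J N)
  map f := ModuleCat.ofHom
    (((weylTorsionFunctor I).map f).hom.prodMap ((weylTorsionFunctor J).map f).hom)
  map_id _ := rfl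
  map_comp _ _ := rfl

instance : (weylTorsionProd I J).Additive where
  map_add := rfl

/-- `Γ_{I+J}(N) ⟶ Γ_I(N) × Γ_J(N)`, `x ↦ (x, x)`, for an `A_n(K)`-module `N`. -/
noncomputable def weylMvDiag : weylTorsionFunctor (I ⊔ J) ⟶ weylTorsionProd I J where
  app N := ModuleCat.ofHom
    (((weylTorsionIncl le_sup_left).app N).hom.prod ((weylTorsionIncl le_sup_right).app N).hom)
  naturality _ _ _ := rfl

/-- `Γ_I(N) × Γ_J(N) ⟶ Γ_{I∩J}(N)`, `(x, y) ↦ x - y`, for an `A_n(K)`-module `N`. -/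
noncomputable def weylMvDiff : weylTorsionProd I J ⟶ weylTorsionFunctor (I ⊓ J) where
  app N := ModuleCat.ofHom
    { toFun x := ⟨x.1.1 - x.2.1, sub_mem (weylTorsion_anti inf_le_left N x.1.2)
        (weylTorsion_anti inf_le_right N x.2.2)⟩
      map_add' x y := Subtype.ext (add_sub_add_comm x.1.1 y.1.1 x.2.1 y.2.1)
      map_smul' P x := Subtype.ext (smul_sub P x.1.1 x.2.1).symm }
  naturality M N f := by
    ext x
    exact Subtype.ext (map_sub f.hom (x.1 : M) (x.2 : M)).symm

/-- The sequence of complexes of `A_n(K)`-modules `Γ_{I+J}(Q) ⟶ Γ_I(Q) ⊕ Γ_J(Q) ⟶ Γ_{I∩J}(Q)`. -/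
noncomputable def weylMvShortComplex (Q : CochainComplex (ModuleCat.{u} (weylAlgebra K n)) ℕ) :
    ShortComplex (CochainComplex (ModuleCat.{u} (weylAlgebra K n)) ℕ) where
  X₁ := weylTorsionComplex (I ⊔ J) Q
  X₂ := ((weylTorsionProd I J).mapHomologicalComplex (ComplexShape.up ℕ)).obj Q
  X₃ := weylTorsionComplex (I ⊓ J) Q
  f := (NatTrans.mapHomologicalComplex (weylMvDiag I J) (ComplexShape.up ℕ)).app Q
  g := (NatTrans.mapHomologicalComplex (weylMvDiff I J) (ComplexShape.up ℕ)).app Q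
  zero := by
    ext j x
    exact Subtype.ext (sub_self (G := Q.X j) x.1)

theorem weylMvShortComplex_shortExact [CharZero K]
    (Q : CochainComplex (ModuleCat.{u} (weylAlgebra K n)) ℕ) (hQ : ∀ j, Injective (Q.X j)) :
    (weylMvShortComplex I J Q).ShortExact := by
  refine HomologicalComplex.shortExact_of_degreewise_shortExact _ fun j => ?_
  have h := (mvShortComplex_shortExact I J (weylResComplex Q) fun j =>
    (weylRes K n).injective_obj_of_injective (hQ j)).map_of_exact (HomologicalComplex.eval _ _ j)
  have hexact := (ShortComplex.ShortExact.moduleCat_exact_iff_function_exact _).1 h.exact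
  have hinj := (ModuleCat.mono_iff_injective _).1 h.mono_f
  have hsurj := (ModuleCat.epi_iff_surjective _).1 h.epi_g
  exact .mk' ((ShortComplex.ShortExact.moduleCat_exact_iff_function_exact _).2 hexact)
    ((ModuleCat.mono_iff_injective _).2 hinj) ((ModuleCat.epi_iff_surjective _).2 hsurj)

end Torsion

section CohComparison
variable {K : Type u} [Field K] {n : ℕ}

theorem torsionComparison_eq (L : Ideal (MvPolynomial (Fin n) K))
    {Q : CochainComplex (ModuleCat.{u} (weylAlgebra K n)) ℕ}
    {E : CochainComplex (ModuleCat.{u} (MvPolynomial (Fin n) K)) ℕ} (c : weylResComplex Q ⟶ E) :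
    torsionComparison L c = torsionComparison L (𝟙 (weylResComplex Q)) ≫
      ((torsionFunctor L).mapHomologicalComplex (ComplexShape.up ℕ)).map c := rfl

instance torsionComparison_id_isIso (L : Ideal (MvPolynomial (Fin n) K))
    (Q : CochainComplex (ModuleCat.{u} (weylAlgebra K n)) ℕ) :
    IsIso (torsionComparison L (𝟙 (weylResComplex Q))) := by
  have (j : ℕ) : IsIso ((torsionComparison L (𝟙 (weylResComplex Q))).f j) := by
    rw [ConcreteCategory.isIso_iff_bijective]
    exact ⟨fun _ _ h => Subtype.ext (congrArg Subtype.val h), fun x => ⟨⟨x.1, x.2⟩, rfl⟩⟩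
  exact HomologicalComplex.Hom.isIso_of_components _

variable {Q Q' : InjectiveResolution (polyD K n)} {E : InjectiveResolution (polyR K n)}

theorem cohComparison_eq_comp (L : Ideal (MvPolynomial (Fin n) K))
    (c : weylResComplex Q.cocomplex ⟶ E.cocomplex) (i : ℕ) :
    cohComparison L c i =
      (mapComplexHomologyIso (weylRes K n) (weylTorsionComplex L Q.cocomplex) i).hom ≫
        HomologicalComplex.homologyMap (torsionComparison L c) i := rfl

theorem exists_isComparison [CharZero K] (Q : InjectiveResolution (polyD K n))
    (E : InjectiveResolution (polyR K n)) : ∃ c, IsComparison Q E c :=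
  ⟨InjectiveResolution.desc (𝟙 _) E (mapInjectiveResolution (weylRes K n) (polyIso K n) Q),
    (isComparison_iff _).2 (by simp)⟩

theorem IsComparison.map_comp {c : weylResComplex Q'.cocomplex ⟶ E.cocomplex}
    (hc : IsComparison Q' E c) {f : Q.cocomplex ⟶ Q'.cocomplex} (hf : Q.ι ≫ f = Q'.ι) :
    IsComparison Q E (((weylRes K n).mapHomologicalComplex (ComplexShape.up ℕ)).map f ≫ c) :=
  fun r => (congrArg (c.f 0).hom (congrArg (fun g => (g.f 0).hom r) hf)).trans (hc r)

theorem IsComparison.nonempty_homotopy [CharZero K]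
    {c c' : weylResComplex Q.cocomplex ⟶ E.cocomplex} (hc : IsComparison Q E c)
    (hc' : IsComparison Q E c') : Nonempty (Homotopy c c') :=
  ⟨InjectiveResolution.descHomotopy
    (I := mapInjectiveResolution (weylRes K n) (polyIso K n) Q) (J := E) (𝟙 (polyR K n)) c c'
    (((isComparison_iff c).1 hc).trans (by simp)) (((isComparison_iff c').1 hc').trans (by simp))⟩

theorem IsComparison.cohComparison_eq [CharZero K]
    {c c' : weylResComplex Q.cocomplex ⟶ E.cocomplex} (hc : IsComparison Q E c)
    (hc' : IsComparison Q E c') (L : Ideal (MvPolynomial (Fin n) K)) (i : ℕ) :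
    cohComparison L c i = cohComparison L c' i := by
  obtain ⟨h⟩ := hc.nonempty_homotopy hc'
  rw [cohComparison_eq_comp, cohComparison_eq_comp, torsionComparison_eq L c,
    torsionComparison_eq L c', HomologicalComplex.homologyMap_comp,
    HomologicalComplex.homologyMap_comp, ((torsionFunctor L).mapHomotopy h).homologyMap_eq]

theorem IsComparison.isIso_cohComparison [CharZero K]
    {c : weylResComplex Q.cocomplex ⟶ E.cocomplex} (hc : IsComparison Q E c)
    (L : Ideal (MvPolynomial (Fin n) K)) (i : ℕ) : IsIso (cohComparison L c i) := by
  let e := InjectiveResolution.homotopyEquiv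
    (mapInjectiveResolution (weylRes K n) (polyIso K n) Q) E
  have he : IsComparison Q E e.hom :=
    (isComparison_iff _).2 (InjectiveResolution.homotopyEquiv_hom_ι _ _)
  obtain ⟨h⟩ := hc.nonempty_homotopy he
  have : IsIso (HomologicalComplex.homologyMap
      (((torsionFunctor L).mapHomologicalComplex (ComplexShape.up ℕ)).map c) i) := by
    rw [((torsionFunctor L).mapHomotopy h).homologyMap_eq]
    exact (((torsionFunctor L).mapHomotopyEquiv e).toHomologyIso i).isIso_hom
  rw [cohComparison_eq_comp, torsionComparison_eq L c, HomologicalComplex.homologyMap_comp]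
  infer_instance

theorem IsComparison.bijective_cohComparison [CharZero K]
    {c : weylResComplex Q.cocomplex ⟶ E.cocomplex} (hc : IsComparison Q E c)
    (L : Ideal (MvPolynomial (Fin n) K)) (i : ℕ) : Function.Bijective (cohComparison L c i) :=
  (ConcreteCategory.isIso_iff_bijective _).1 (hc.isIso_cohComparison L i)

theorem map_homologyMap_cohComparison {L L' : Ideal (MvPolynomial (Fin n) K)}
    {c : weylResComplex Q.cocomplex ⟶ E.cocomplex}
    {c' : weylResComplex Q'.cocomplex ⟶ E.cocomplex}
    (φ : weylTorsionComplex L Q.cocomplex ⟶ weylTorsionComplex L' Q'.cocomplex)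
    (ψ : torsionComplex L E.cocomplex ⟶ torsionComplex L' E.cocomplex)
    (h : ((weylRes K n).mapHomologicalComplex (ComplexShape.up ℕ)).map φ ≫
        torsionComparison L' c' = torsionComparison L c ≫ ψ) (i : ℕ) :
    (weylRes K n).map (HomologicalComplex.homologyMap φ i) ≫ cohComparison L' c' i =
      cohComparison L c i ≫ HomologicalComplex.homologyMap ψ i := by
  rw [cohComparison_eq_comp, cohComparison_eq_comp, ← Category.assoc,
    mapComplexHomologyIso_hom_naturality, Category.assoc, Category.assoc,
    ← HomologicalComplex.homologyMap_comp, ← HomologicalComplex.homologyMap_comp, h]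

theorem map_cohComparison (L : Ideal (MvPolynomial (Fin n) K)) (f : Q.cocomplex ⟶ Q'.cocomplex)
    (c : weylResComplex Q'.cocomplex ⟶ E.cocomplex) (i : ℕ) :
    (weylRes K n).map (HomologicalComplex.homologyMap
        (((weylTorsionFunctor L).mapHomologicalComplex (ComplexShape.up ℕ)).map f) i) ≫
        cohComparison L c i =
      cohComparison L (((weylRes K n).mapHomologicalComplex (ComplexShape.up ℕ)).map f ≫ c) i := by
  have h := map_homologyMap_cohComparison
    (((weylTorsionFunctor L).mapHomologicalComplex (ComplexShape.up ℕ)).map f) (𝟙 _)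
    (c := ((weylRes K n).mapHomologicalComplex (ComplexShape.up ℕ)).map f ≫ c) (c' := c) rfl i
  rwa [HomologicalComplex.homologyMap_id, Category.comp_id] at h

theorem cohComparison_cohIncl {L L' : Ideal (MvPolynomial (Fin n) K)} (h : L ≤ L')
    (c : weylResComplex Q.cocomplex ⟶ E.cocomplex) (i : ℕ) :
    cohComparison L' c i ≫ ModuleCat.ofHom (cohIncl E h i) =
      (weylRes K n).map (HomologicalComplex.homologyMap ((NatTrans.mapHomologicalComplex
        (weylTorsionIncl h) (ComplexShape.up ℕ)).app Q.cocomplex) i) ≫ cohComparison L c i :=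
  (map_homologyMap_cohComparison _ _ rfl i).symm

/-- The morphism from the Mayer–Vietoris sequence of complexes of `Q` to that of `E` induced by
`c : Q ⟶ E`. -/
noncomputable def weylMvComparison (I J : Ideal (MvPolynomial (Fin n) K))
    {Q : CochainComplex (ModuleCat.{u} (weylAlgebra K n)) ℕ}
    {E : CochainComplex (ModuleCat.{u} (MvPolynomial (Fin n) K)) ℕ} (c : weylResComplex Q ⟶ E) :
    (weylMvShortComplex I J Q).map
        ((weylRes K n).mapHomologicalComplex (ComplexShape.up ℕ)) ⟶ mvShortComplex I J E where
  τ₁ := torsionComparison (I ⊔ J) c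
  τ₂ :=
    { f j := ModuleCat.ofHom (X := (weylRes K n).obj ((weylTorsionProd I J).obj (Q.X j)))
        { toFun x := (((torsionComparison I c).f j).hom x.1, ((torsionComparison J c).f j).hom x.2)
          map_add' x y := Prod.ext (map_add ((torsionComparison I c).f j).hom x.1 y.1)
            (map_add ((torsionComparison J c).f j).hom x.2 y.2)
          map_smul' r x := Prod.ext (((torsionComparison I c).f j).hom.map_smul' r x.1)
            (((torsionComparison J c).f j).hom.map_smul' r x.2) }
      comm' j k _ := by
        ext x
        exact Prod.ext (congrArg (fun f => f.hom x.1) ((torsionComparison I c).comm j k))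
          (congrArg (fun f => f.hom x.2) ((torsionComparison J c).comm j k)) }
  τ₃ := torsionComparison (I ⊓ J) c
  comm₁₂ := rfl
  comm₂₃ := by
    ext j x
    exact Subtype.ext (map_sub (c.f j).hom x.1.1 x.2.1).symm

theorem cohComparison_mvDelta [CharZero K] (I J : Ideal (MvPolynomial (Fin n) K))
    (c : weylResComplex Q.cocomplex ⟶ E.cocomplex) (i : ℕ) :
    cohComparison (I ⊓ J) c i ≫ ModuleCat.ofHom (mvDelta E I J i) =
      (weylRes K n).map
          ((weylMvShortComplex_shortExact I J Q.cocomplex Q.injective).δ i (i + 1) rfl) ≫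
        cohComparison (I ⊔ J) c (i + 1) := by
  have hQ := weylMvShortComplex_shortExact I J Q.cocomplex Q.injective
  have hE := mvShortComplex_shortExact I J E.cocomplex E.injective
  have hδ := map_δ_mapComplexHomologyIso_hom (weylRes K n) hQ i (i + 1) rfl
  have hnat := HomologicalComplex.HomologySequence.δ_naturality (weylMvComparison I J c)
    (shortExact_map_mapHomologicalComplex (weylRes K n) hQ) hE i (i + 1) rfl
  have hleft := (Category.assoc _ _ _).trans
    (congrArg ((mapComplexHomologyIso (weylRes K n) _ i).hom ≫ ·) hnat.symm)
  have hright := (congrArg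
    (· ≫ HomologicalComplex.homologyMap (torsionComparison (I ⊔ J) c) (i + 1)) hδ.symm).trans
      (Category.assoc _ _ _)
  exact hleft.trans ((Category.assoc _ _ _).symm.trans hright)

end CohComparison

section WeylLinear

variable {K : Type u} [Field K] {n : ℕ} {Q Q' : InjectiveResolution (polyD K n)}
  {E : InjectiveResolution (polyR K n)}

/-- The `A_n(K)`-module structure on `H^i_L(R)` transported from `H^i(Γ_L(Q))` along the bijection
induced by a comparison map `c : Q ⟶ E`. -/
@[reducible]
noncomputable def IsComparison.localCohModule [CharZero K]
    {c : weylResComplex Q.cocomplex ⟶ E.cocomplex} (hc : IsComparison Q E c)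
    (L : Ideal (MvPolynomial (Fin n) K)) (i : ℕ) : Module (weylAlgebra K n) (localCoh L E i) :=
  (AddEquiv.ofBijective (M := (weylTorsionComplex L Q.cocomplex).homology i)
    (cohComparison L c i).hom.toAddMonoidHom (hc.bijective_cohComparison L i)).symm.module _

/-- The maps `H^i(Γ_L(Q)) ⟶ H^i_L(R)` induced by `c : Q ⟶ E` are `A_n(K)`-linear. They are bundled
as `R`-linear maps, hence the elementwise form. -/
def InducesWeylLinear
    [∀ (L : Ideal (MvPolynomial (Fin n) K)) (i : ℕ), Module (weylAlgebra K n) (localCoh L E i)]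
    (c : weylResComplex Q.cocomplex ⟶ E.cocomplex) : Prop :=
  ∀ (L : Ideal (MvPolynomial (Fin n) K)) (i : ℕ) (P : weylAlgebra K n)
    (y : (weylTorsionComplex L Q.cocomplex).homology i),
    (cohComparison L c i).hom (P • y) = P • (cohComparison L c i).hom y

theorem IsComparison.inducesWeylLinear_localCohModule [CharZero K]
    {c : weylResComplex Q.cocomplex ⟶ E.cocomplex} (hc : IsComparison Q E c) :
    letI := hc.localCohModule
    InducesWeylLinear c := by
  intro L i P y
  let e := AddEquiv.ofBijective (M := (weylTorsionComplex L Q.cocomplex).homology i)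
    (cohComparison L c i).hom.toAddMonoidHom (hc.bijective_cohComparison L i)
  exact congrArg (fun z => e (P • z)) (e.symm_apply_apply y).symm

variable [∀ (L : Ideal (MvPolynomial (Fin n) K)) (i : ℕ), Module (weylAlgebra K n) (localCoh L E i)]
  {c : weylResComplex Q.cocomplex ⟶ E.cocomplex}

theorem InducesWeylLinear.toWeyl_smul [CharZero K] (hlin : InducesWeylLinear c)
    (hc : IsComparison Q E c) (L : Ideal (MvPolynomial (Fin n) K)) (i : ℕ)
    (r : MvPolynomial (Fin n) K) (x : localCoh L E i) : toWeyl K n r • x = r • x := by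
  obtain ⟨y, rfl⟩ := (hc.bijective_cohComparison L i).2 x
  exact (hlin L i (toWeyl K n r) y).symm.trans (map_smul (cohComparison L c i).hom r y)

theorem InducesWeylLinear.of_isComparison [CharZero K] (hlin : InducesWeylLinear c)
    (hc : IsComparison Q E c) {c' : weylResComplex Q'.cocomplex ⟶ E.cocomplex}
    (hc' : IsComparison Q' E c') : InducesWeylLinear c' := by
  intro L i P y
  let f := InjectiveResolution.desc (𝟙 (polyD K n)) Q Q'
  have hf : IsComparison Q' E (((weylRes K n).mapHomologicalComplex _).map f ≫ c) :=
    hc.map_comp (by simp [f])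
  let g := HomologicalComplex.homologyMap
    (((weylTorsionFunctor L).mapHomologicalComplex (ComplexShape.up ℕ)).map f) i
  have hg (z : (weylTorsionComplex L Q'.cocomplex).homology i) :
      (cohComparison L c' i).hom z = (cohComparison L c i).hom (g.hom z) :=
    congrArg (fun φ => φ.hom z)
      ((hc'.cohComparison_eq hf L i).trans (map_cohComparison L f c i).symm)
  calc (cohComparison L c' i).hom (P • y)
    _ = (cohComparison L c i).hom (g.hom (P • y)) := hg _
    _ = (cohComparison L c i).hom (P • g.hom y) :=
      congrArg (cohComparison L c i).hom (map_smul g.hom P y)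
    _ = P • (cohComparison L c i).hom (g.hom y) := hlin L i P _
    _ = P • (cohComparison L c' i).hom y := by rw [hg]

theorem InducesWeylLinear.map_smul_of_comp_eq [CharZero K] (hlin : InducesWeylLinear c)
    (hc : IsComparison Q E c) {L L' : Ideal (MvPolynomial (Fin n) K)} {i j : ℕ}
    {f : localCoh L E i →ₗ[MvPolynomial (Fin n) K] localCoh L' E j}
    {g : (weylTorsionComplex L Q.cocomplex).homology i ⟶
      (weylTorsionComplex L' Q.cocomplex).homology j}
    (h : cohComparison L c i ≫ ModuleCat.ofHom f = (weylRes K n).map g ≫ cohComparison L' c j)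
    (P : weylAlgebra K n) (x : localCoh L E i) : f (P • x) = P • f x := by
  obtain ⟨y, rfl⟩ := (hc.bijective_cohComparison L i).2 x
  have hfg (z : (weylTorsionComplex L Q.cocomplex).homology i) :
      f ((cohComparison L c i).hom z) = (cohComparison L' c j).hom (g.hom z) :=
    congrArg (fun φ => φ.hom z) h
  calc f (P • (cohComparison L c i).hom y)
    _ = f ((cohComparison L c i).hom (P • y)) := congrArg f (hlin L i P y).symm
    _ = (cohComparison L' c j).hom (g.hom (P • y)) := hfg _
    _ = (cohComparison L' c j).hom (P • g.hom y) :=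
      congrArg (cohComparison L' c j).hom (map_smul g.hom P y)
    _ = P • (cohComparison L' c j).hom (g.hom y) := hlin L' j P _
    _ = P • f ((cohComparison L c i).hom y) := congrArg (P • ·) (hfg y).symm

theorem InducesWeylLinear.cohIncl_smul [CharZero K] (hlin : InducesWeylLinear c)
    (hc : IsComparison Q E c) {L L' : Ideal (MvPolynomial (Fin n) K)} (h : L ≤ L') (i : ℕ)
    (P : weylAlgebra K n) (x : localCoh L' E i) :
    cohIncl E h i (P • x) = P • cohIncl E h i x :=
  hlin.map_smul_of_comp_eq hc (cohComparison_cohIncl h c i) P x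

theorem InducesWeylLinear.mvRho_smul [CharZero K] (hlin : InducesWeylLinear c)
    (hc : IsComparison Q E c) (I J : Ideal (MvPolynomial (Fin n) K)) (i : ℕ) (P : weylAlgebra K n)
    (x : localCoh (I ⊔ J) E i) :
    mvRho E I J i (P • x) = P • mvRho E I J i x :=
  Prod.ext (hlin.cohIncl_smul hc le_sup_left i P x) (hlin.cohIncl_smul hc le_sup_right i P x)

theorem InducesWeylLinear.mvPi_smul [CharZero K] (hlin : InducesWeylLinear c)
    (hc : IsComparison Q E c) (I J : Ideal (MvPolynomial (Fin n) K)) (i : ℕ) (P : weylAlgebra K n)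
    (x : localCoh I E i × localCoh J E i) :
    mvPi E I J i (P • x) = P • mvPi E I J i x :=
  (congrArg₂ (· - ·) (hlin.cohIncl_smul hc inf_le_left i P x.1)
    (hlin.cohIncl_smul hc inf_le_right i P x.2)).trans (smul_sub P _ _).symm

theorem InducesWeylLinear.mvDelta_smul [CharZero K] (hlin : InducesWeylLinear c)
    (hc : IsComparison Q E c) (I J : Ideal (MvPolynomial (Fin n) K)) (i : ℕ) (P : weylAlgebra K n)
    (x : localCoh (I ⊓ J) E i) :
    mvDelta E I J i (P • x) = P • mvDelta E I J i x :=
  hlin.map_smul_of_comp_eq hc (cohComparison_mvDelta I J c i) P x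

end WeylLinear

end MVWeyl

theorem mainTheorem5 {K : Type u} [Field K] [CharZero K] (n : ℕ)
    (E : InjectiveResolution (MVWeyl.polyR K n)) :
    ∃ mod : ∀ (L : Ideal (MvPolynomial (Fin n) K)) (i : ℕ),
        Module (MVWeyl.weylAlgebra K n) (MVWeyl.localCoh L E i),
      (∀ (L : Ideal (MvPolynomial (Fin n) K)) (i : ℕ) (r : MvPolynomial (Fin n) K)
        (x : MVWeyl.localCoh L E i), MVWeyl.toWeyl K n r • x = r • x) ∧
      (∀ Q : InjectiveResolution (MVWeyl.polyD K n),
        (∃ c, MVWeyl.IsComparison Q E c) ∧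
        ∀ c, MVWeyl.IsComparison Q E c → ∀ (L : Ideal (MvPolynomial (Fin n) K)) (i : ℕ),
          Function.Bijective (MVWeyl.cohComparison L c i) ∧
          ∀ (P : MVWeyl.weylAlgebra K n)
            (y : (MVWeyl.weylTorsionComplex L Q.cocomplex).homology i),
            (MVWeyl.cohComparison L c i).hom (P • y) =
              P • (MVWeyl.cohComparison L c i).hom y) ∧
      ∀ (I J : Ideal (MvPolynomial (Fin n) K)) (i : ℕ) (P : MVWeyl.weylAlgebra K n),
        (∀ x, MVWeyl.mvRho E I J i (P • x) = P • MVWeyl.mvRho E I J i x) ∧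
        (∀ x, MVWeyl.mvPi E I J i (P • x) = P • MVWeyl.mvPi E I J i x) ∧
        (∀ x, MVWeyl.mvDelta E I J i (P • x) = P • MVWeyl.mvDelta E I J i x) := by
  obtain ⟨c, hc⟩ := MVWeyl.exists_isComparison (InjectiveResolution.of (MVWeyl.polyD K n)) E
  let := hc.localCohModule
  have hlin : MVWeyl.InducesWeylLinear c := hc.inducesWeylLinear_localCohModule
  refine ⟨hc.localCohModule, hlin.toWeyl_smul hc, fun Q => ⟨MVWeyl.exists_isComparison Q E, ?_⟩, ?_⟩
  · intro c' hc' L i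
    exact ⟨hc'.bijective_cohComparison L i, hlin.of_isComparison hc hc' L i⟩
  · intro I J i P
    exact ⟨hlin.mvRho_smul hc I J i P, hlin.mvPi_smul hc I J i P, hlin.mvDelta_smul hc I J i P⟩
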